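/- Let $d \ge 1$ be an integer and let $\alpha > -1$ be real. Let $B^d = \{x \in \mathbb{R}^d : |x| < 1\}$ be the open Euclidean unit ball, $\rho(x) = 1 - |x|^2$, and $\|u\|_{L^2_{\rho^\alpha}(B^d)} = \big(\int_{B^d} |u(x)|^2 \rho(x)^\alpha \, dx\big)^{1/2}$, where $|\cdot|$ denotes the Euclidean (Hermitian) norm when $u$ is vector-valued. Then there exists a constant $C = C(\alpha, d) > 0$ such that for every integer $N \ge 0$ and every polynomial $p$ in $d$ variables with complex coefficients and of total degree at most $N$, both $p$ and its gradient $\nabla p$ have finite norm and $$\|\nabla p\|_{L^2_{\rho^\alpha}(B^d)} \le C N^2 \, \|p\|_{L^2_{\rho^\alpha}(B^d)}.$$ -/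

import Mathlib

open MeasureTheory
open scoped ENNReal

noncomputable section

/-- The weighted measure `ρ ^ α dx` on the open Euclidean unit ball `B^d`, where
`ρ x = 1 - ‖x‖ ^ 2` (which is positive on the ball). Then `L²_{ρ^α}(B^d)` is `L²` with respect
to this measure. -/
def ballMeasure (d : ℕ) (α : ℝ) : Measure (EuclideanSpace ℝ (Fin d)) :=
  (volume.restrict (Metric.ball (0 : EuclideanSpace ℝ (Fin d)) 1)).withDensity
    (fun x => ENNReal.ofReal ((1 - ‖x‖ ^ 2) ^ α))

/-- The complex-valued function on `ℝ^d` defined by a polynomial with complex coefficients. -/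
def polyFun {d : ℕ} (p : MvPolynomial (Fin d) ℂ) (x : EuclideanSpace ℝ (Fin d)) : ℂ :=
  MvPolynomial.eval (fun i => (x i : ℂ)) p

/-- The gradient `(∂₁ u, …, ∂_d u)` of a complex-valued function of `d` real variables, a vector
of `ℂ^d` with its Hermitian norm. -/
def complexGrad {d : ℕ} (u : EuclideanSpace ℝ (Fin d) → ℂ) (x : EuclideanSpace ℝ (Fin d)) :
    EuclideanSpace ℂ (Fin d) :=
  WithLp.toLp 2 (fun i => lineDeriv ℝ u x (EuclideanSpace.single i (1 : ℝ)))

end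

/-! Integration by parts makes `L_i = -ρ^{-α} ∂ᵢ(ρ^{α+1} ∂ᵢ ·)` symmetric for the weight `ρ^α`, with
quadratic form `∫ ρ^{α+1} |∂ᵢ p|²`. It maps polynomials of degree at most `N` to themselves, so that
form is bounded by its largest eigenvalue there. Comparing coefficients at a monomial of highest
`xᵢ`-degree `k ≤ N` shows that each eigenvalue is `k(k-1) + 2(α+1)k`, which is `O(N²)`. This is the
Bernstein inequality `map_rho_mul_pderiv_sq_le`, where the gradient carries an extra factor `ρ`.

That factor is removed by the Schur inequality `map_sq_le`: integrating by parts against the field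
`x q²` bounds `∫ ρ^α q²` by `∫ ρ^{α+1} q²` plus a cross term in `q ∂ᵢq`, which Young's inequality
and Bernstein absorb. Taking `q = ∂ᵢp` multiplies the two losses of order `N²` into `N⁴` for squared
norms. Complex polynomials split into real and imaginary parts. -/

open MvPolynomial in
theorem MvPolynomial.totalDegree_pderiv_add_one_le {σ : Type*} {R : Type*} [CommSemiring R] (i : σ)
    (p : MvPolynomial σ R) (hp : pderiv i p ≠ 0) :
    (pderiv i p).totalDegree + 1 ≤ p.totalDegree := by
  classical
  obtain ⟨m, hm, hmd⟩ := Finset.exists_mem_eq_sup _ (support_nonempty.2 hp)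
    (fun m : σ →₀ ℕ => m.sum fun _ e => e)
  have hm' : m + Finsupp.single i 1 ∈ p.support := by
    rw [mem_support_iff] at hm ⊢
    rw [coeff_pderiv] at hm
    exact left_ne_zero_of_mul hm
  have h := le_totalDegree hm'
  rw [Finsupp.sum_add_index' (by simp) (by simp), Finsupp.sum_single_index rfl] at h
  rw [totalDegree, hmd]
  exact h

/-- A linear operator on a finite-dimensional real space that is symmetric for a positive definite
bilinear form has its quadratic form bounded by its largest eigenvalue. -/
theorem LinearMap.quadraticForm_le_of_hasEigenvalue_le {V : Type*} [AddCommGroup V] [Module ℝ V]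
    [FiniteDimensional ℝ V] (B : V →ₗ[ℝ] V →ₗ[ℝ] ℝ) (hsymm : ∀ x y, B x y = B y x)
    (hnonneg : ∀ x, 0 ≤ B x x) (hdef : ∀ x, B x x = 0 → x = 0) (T : V →ₗ[ℝ] V)
    (hT : ∀ x y, B (T x) y = B x (T y)) (c : ℝ)
    (hc : ∀ μ x, x ≠ 0 → T x = μ • x → μ ≤ c) (x : V) : B (T x) x ≤ c * B x x := by
  -- With `B` as inner product the spectral theorem applies, and Parseval in an eigenbasis writes
  -- the form as a sum of eigenvalues times squared coordinates.
  let core : InnerProductSpace.Core ℝ V :=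
    { inner := fun x y => B x y
      conj_inner_symm := fun x y => by simpa using hsymm y x
      re_inner_nonneg := fun x => by simpa using hnonneg x
      add_left := fun x y z => by simp
      smul_left := fun x y r => by simp
      definite := hdef }
  let : NormedAddCommGroup V := core.toNormedAddCommGroup
  let : InnerProductSpace ℝ V := InnerProductSpace.ofCore core.toCore
  have hTs : T.IsSymmetric := fun x y => hT x y
  set b := hTs.eigenvectorBasis rfl
  have h1 : B (T x) x = inner ℝ (T x) x := rfl
  have h2 : B x x = inner ℝ x x := rfl
  rw [h1, h2, ← b.sum_inner_mul_inner, ← b.sum_inner_mul_inner, Finset.mul_sum]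
  refine Finset.sum_le_sum fun i _ => ?_
  have hb : T (b i) = hTs.eigenvalues rfl i • b i := hTs.apply_eigenvectorBasis rfl i
  have hle := hc _ _ (b.orthonormal.ne_zero i) hb
  rw [hTs x (b i), hb, inner_smul_right, real_inner_comm x (b i)]
  nlinarith [mul_self_nonneg (inner ℝ x (b i) : ℝ)]

/-! ### The Jacobi-type operators and their eigenvalues -/

namespace BallMarkov
open MvPolynomial

variable {d : ℕ}

/-- The polynomial `1 - |x| ^ 2`. -/
noncomputable def rho (d : ℕ) : MvPolynomial (Fin d) ℝ := 1 - ∑ j, X j ^ 2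

/-- The Jacobi-type operator `-ρ^{-α} ∂ᵢ (ρ^{α+1} ∂ᵢ ·)`. -/
noncomputable def jacobi (α : ℝ) (i : Fin d) :
    MvPolynomial (Fin d) ℝ →ₗ[ℝ] MvPolynomial (Fin d) ℝ :=
  -(LinearMap.mulLeft ℝ (rho d) ∘ₗ (pderiv i).toLinearMap ∘ₗ (pderiv i).toLinearMap) +
    (2 * (α + 1)) • (LinearMap.mulLeft ℝ (X i) ∘ₗ (pderiv i).toLinearMap)

theorem jacobi_apply (α : ℝ) (i : Fin d) (p : MvPolynomial (Fin d) ℝ) :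
    jacobi α i p = -(rho d * pderiv i (pderiv i p)) + (2 * (α + 1)) • (X i * pderiv i p) := by
  simp [jacobi]

theorem totalDegree_rho_le : (rho d).totalDegree ≤ 2 := by
  refine (totalDegree_sub _ _).trans (max_le (by simp) ?_)
  refine totalDegree_finsetSum_le fun j _ => ?_
  simp

theorem totalDegree_jacobi_le (α : ℝ) (i : Fin d) (p : MvPolynomial (Fin d) ℝ) :
    (jacobi α i p).totalDegree ≤ p.totalDegree := by
  rw [jacobi_apply]
  refine (totalDegree_add _ _).trans (max_le ?_ ?_)
  · rw [totalDegree_neg]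
    by_cases h : pderiv i (pderiv i p) = 0
    · simp [h]
    have h1 := totalDegree_pderiv_add_one_le i _ h
    have h2 := totalDegree_pderiv_add_one_le i p (by rintro h0; simp [h0] at h)
    have := totalDegree_mul (rho d) (pderiv i (pderiv i p))
    have := totalDegree_rho_le (d := d)
    omega
  · refine (totalDegree_smul_le _ _).trans ?_
    by_cases h : pderiv i p = 0
    · simp [h]
    have h1 := totalDegree_pderiv_add_one_le i _ h
    have := totalDegree_mul (X i) (pderiv i p)
    rw [totalDegree_X] at this
    omega

theorem coeff_X_mul_pderiv (i : Fin d) (p : MvPolynomial (Fin d) ℝ) (m : Fin d →₀ ℕ) :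
    coeff m (X i * pderiv i p) = m i * coeff m p := by
  rw [coeff_X_mul']
  split_ifs with h
  · rw [coeff_pderiv]
    have h1 : 1 ≤ m i := Nat.one_le_iff_ne_zero.2 (Finsupp.mem_support_iff.1 h)
    rw [tsub_add_cancel_of_le (Finsupp.single_le_iff.2 h1)]
    have : (m - Finsupp.single i 1 : Fin d →₀ ℕ) i + 1 = m i := by simp; omega
    rw [mul_comm]
    exact_mod_cast congrArg (fun k : ℕ => (k : ℝ) * coeff m p) this
  · simp [Finsupp.notMem_support_iff.1 h]

theorem coeff_X_sq_mul_pderiv (i : Fin d) (p : MvPolynomial (Fin d) ℝ) (m : Fin d →₀ ℕ) :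
    coeff m (X i ^ 2 * pderiv i (pderiv i p)) = (m i * (m i - 1)) * coeff m p := by
  -- With the Euler operator `θ = xᵢ∂ᵢ`, this is `xᵢ²∂ᵢ² = θ² - θ`, and `θ` is diagonal on
  -- monomials.
  have : X i ^ 2 * pderiv i (pderiv i p) =
      X i * pderiv i (X i * pderiv i p) - X i * pderiv i p := by
    simp; ring
  rw [this, coeff_sub, coeff_X_mul_pderiv, coeff_X_mul_pderiv]
  ring

/-- At a monomial of top degree in `xᵢ`, the Jacobi operator acts as a scalar. -/
theorem coeff_jacobi (α : ℝ) (i : Fin d) (p : MvPolynomial (Fin d) ℝ) (m : Fin d →₀ ℕ)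
    (hm : degreeOf i p ≤ m i) :
    coeff m (jacobi α i p) = (m i * (m i - 1) + 2 * (α + 1) * m i) * coeff m p := by
  -- Such a coefficient comes from an exponent `m i + 2` of `xᵢ` in `p`, beyond its degree. Hence
  -- only the `xᵢ²` term of `ρ` contributes to the second-order part.
  have hz : ∀ m' : Fin d →₀ ℕ, m' i = m i → coeff m' (pderiv i (pderiv i p)) = 0 := by
    intro m' hm'
    rw [coeff_pderiv, coeff_pderiv]
    have : coeff (m' + Finsupp.single i 1 + Finsupp.single i 1) p = 0 := by
      by_contra h
      have := degreeOf_le_iff.1 hm _ (mem_support_iff.2 h)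
      simp at this
      omega
    simp [this]
  have hj : ∀ j ≠ i, coeff m (X j ^ 2 * pderiv i (pderiv i p)) = 0 := by
    intro j hji
    rw [X_pow_eq_monomial, coeff_monomial_mul']
    split_ifs with h
    · rw [hz, mul_zero]
      simp [Finsupp.single_eq_of_ne hji.symm]
    · rfl
  rw [jacobi_apply, coeff_add, coeff_neg, coeff_smul, coeff_X_mul_pderiv, rho, sub_mul, one_mul,
    coeff_sub, hz m rfl, Finset.sum_mul, coeff_sum, Finset.sum_eq_single i (fun j _ => hj j)
    (by simp), coeff_X_sq_mul_pderiv, smul_eq_mul]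
  ring

theorem eigenvalue_jacobi_le {α : ℝ} (hα : -1 < α) (i : Fin d) {N : ℕ}
    {p : MvPolynomial (Fin d) ℝ} (hp : p ≠ 0) (hN : p.totalDegree ≤ N) {c : ℝ}
    (h : jacobi α i p = c • p) : c ≤ (2 * α + 3) * N ^ 2 := by
  obtain ⟨m, hm, hmd⟩ := Finset.exists_mem_eq_sup _ (support_nonempty.2 hp)
    (fun m : Fin d →₀ ℕ => m i)
  rw [← degreeOf_eq_sup] at hmd
  have h1 := coeff_jacobi α i p m hmd.le
  rw [h, coeff_smul, smul_eq_mul] at h1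
  have h2 := mul_right_cancel₀ (mem_support_iff.1 hm) h1
  have h3 : m i ≤ N := by
    rw [← hmd]; exact (degreeOf_le_totalDegree p i).trans hN
  have h4 : (m i : ℝ) ≤ N := by exact_mod_cast h3
  have h5 : (m i : ℝ) ≤ N ^ 2 := by exact_mod_cast h3.trans (Nat.le_self_pow two_ne_zero N)
  have h6 : (0 : ℝ) ≤ m i := Nat.cast_nonneg _
  rw [h2]
  nlinarith

/-- A positive definite linear functional on polynomials satisfying the integration by parts rule
of the weight `ρ ^ α` on the unit ball. -/
structure IsBallFunctional (α : ℝ) (Λ : MvPolynomial (Fin d) ℝ →ₗ[ℝ] ℝ) : Prop where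
  parts : ∀ i f, Λ (rho d * pderiv i f) = 2 * (α + 1) * Λ (X i * f)
  nonneg : ∀ f, (∀ x : Fin d → ℝ, ∑ j, x j ^ 2 < 1 → 0 ≤ eval x f) → 0 ≤ Λ f
  definite : ∀ f, Λ (f * f) = 0 → f = 0

/-! ### Bernstein, Schur and Markov inequalities for an abstract functional -/

namespace IsBallFunctional

variable {α : ℝ} {Λ : MvPolynomial (Fin d) ℝ →ₗ[ℝ] ℝ}

/-- Integration by parts for `∂ᵢp · q`. The right side is symmetric in `p` and `q`, so this yields
both the symmetry of the operator and its quadratic form. -/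
theorem map_jacobi_mul (hΛ : IsBallFunctional α Λ) (i : Fin d) (p q : MvPolynomial (Fin d) ℝ) :
    Λ (jacobi α i p * q) = Λ (rho d * (pderiv i p * pderiv i q)) := by
  have h := hΛ.parts i (pderiv i p * q)
  have e1 : rho d * pderiv i (pderiv i p * q) =
      rho d * pderiv i (pderiv i p) * q + rho d * (pderiv i p * pderiv i q) := by
    rw [pderiv_mul]; ring
  rw [e1, map_add] at h
  rw [jacobi_apply, add_mul, map_add, smul_mul_assoc, map_smul, neg_mul, map_neg, smul_eq_mul,
    mul_assoc (X i), ← h]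
  ring

/-- Bernstein's inequality. -/
theorem map_rho_mul_pderiv_sq_le (hΛ : IsBallFunctional α Λ) (hα : -1 < α) (i : Fin d) {N : ℕ}
    {p : MvPolynomial (Fin d) ℝ} (hp : p.totalDegree ≤ N) :
    Λ (rho d * (pderiv i p * pderiv i p)) ≤ (2 * α + 3) * N ^ 2 * Λ (p * p) := by
  let V := restrictTotalDegree (Fin d) ℝ N
  have : FiniteDimensional ℝ V := inferInstance
  let T : V →ₗ[ℝ] V := (jacobi α i).restrict fun q hq => by
    rw [mem_restrictTotalDegree] at hq ⊢
    exact (totalDegree_jacobi_le α i q).trans hq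
  let B : V →ₗ[ℝ] V →ₗ[ℝ] ℝ := ((LinearMap.mul ℝ (MvPolynomial (Fin d) ℝ)).compr₂ Λ).domRestrict₁₂ V V
  have hB : ∀ x y : V, B x y = Λ (x.1 * y.1) := fun x y => rfl
  have hT : ∀ x : V, (T x).1 = jacobi α i x.1 := fun x => rfl
  have key := LinearMap.quadraticForm_le_of_hasEigenvalue_le B
    (fun x y => by rw [hB, hB, mul_comm])
    (fun x => hΛ.nonneg (x.1 * x.1) fun y _ => by rw [eval_mul]; exact mul_self_nonneg _)
    (fun x hx => Subtype.ext (hΛ.definite _ hx)) T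
    (fun x y => by
      rw [hB, hB, hT, hT, mul_comm x.1, hΛ.map_jacobi_mul, hΛ.map_jacobi_mul,
        mul_comm (pderiv i x.1)])
    ((2 * α + 3) * N ^ 2)
    (fun μ x hx hμ => eigenvalue_jacobi_le hα i (fun h => hx (Subtype.ext h))
      ((mem_restrictTotalDegree _ _ _).1 x.2) (by rw [← hT, hμ]; rfl))
    ⟨p, (mem_restrictTotalDegree _ _ _).2 hp⟩
  rwa [hB, hB, hT, hΛ.map_jacobi_mul] at key

theorem map_le (hΛ : IsBallFunctional α Λ) {f g : MvPolynomial (Fin d) ℝ}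
    (h : ∀ x : Fin d → ℝ, ∑ j, x j ^ 2 < 1 → eval x f ≤ eval x g) : Λ f ≤ Λ g := by
  have := hΛ.nonneg (g - f) fun x hx => by rw [map_sub]; exact sub_nonneg.2 (h x hx)
  rw [map_sub] at this
  linarith

/-- Integration by parts for `xᵢ q²`, summed over `i`, with `∑ xᵢ² = 1 - ρ`. -/
theorem two_mul_map_sq_eq (hΛ : IsBallFunctional α Λ) (q : MvPolynomial (Fin d) ℝ) :
    2 * (α + 1) * Λ (q * q) = (d + 2 * α + 2) * Λ (rho d * (q * q)) +
      ∑ i, Λ (rho d * (2 * X i * q * pderiv i q)) := by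
  have h : ∀ i : Fin d, Λ (rho d * (q * q)) + Λ (rho d * (2 * X i * q * pderiv i q)) =
      2 * (α + 1) * Λ (X i ^ 2 * (q * q)) := fun i => by
    have := hΛ.parts i (X i * (q * q))
    rw [show X i * (X i * (q * q)) = X i ^ 2 * (q * q) by ring] at this
    rw [← this, ← map_add]
    congr 1
    simp only [pderiv_mul, pderiv_X_self]
    ring
  have hs := Finset.sum_congr rfl fun i (_ : i ∈ Finset.univ) => h i
  have e : ∑ i, Λ (X i ^ 2 * (q * q)) = Λ (q * q) - Λ (rho d * (q * q)) := by
    rw [← map_sum, ← Finset.sum_mul, ← map_sub, rho]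
    congr 1
    ring
  rw [Finset.sum_add_distrib, ← Finset.mul_sum, e] at hs
  simp only [Finset.sum_const, Finset.card_univ, Fintype.card_fin, nsmul_eq_mul] at hs
  linarith

/-- A Schur-type inequality: raising the weight exponent by one costs a factor of order `N ^ 2`. -/
theorem map_sq_le (hΛ : IsBallFunctional α Λ) (hα : -1 < α) {N : ℕ} {q : MvPolynomial (Fin d) ℝ}
    (hq : q.totalDegree ≤ N) :
    Λ (q * q) ≤ ((d + 2 * α + 2 + d * ((d + 1) * (2 * α + 3) / (α + 1))) / (α + 1)) * (1 + N ^ 2) *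
      Λ (rho d * (q * q)) := by
  have ha : 0 < α + 1 := by linarith
  set K := 2 * α + 3
  have hK : 0 < K := by simp only [K]; linarith
  -- The added 1 keeps `A` invertible when `N = 0`.
  set M : ℝ := 1 + N ^ 2
  have hM : 1 ≤ M := by simp only [M]; nlinarith [sq_nonneg (N : ℝ)]
  -- The Young parameter is chosen so that `d A⁻¹ K M = (α + 1) d / (d + 1)`: the Bernstein term
  -- then uses up at most half of `2(α + 1) Λ(q²)`.
  set A : ℝ := (d + 1) * K / (α + 1) * M
  have hA : 0 < A := by positivity
  have hpt : ∀ i : Fin d, Λ (rho d * (2 * X i * q * pderiv i q)) ≤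
      A * Λ (rho d * (q * q)) + A⁻¹ * Λ (rho d * (pderiv i q * pderiv i q)) := fun i => by
    rw [← smul_eq_mul A, ← smul_eq_mul A⁻¹, ← map_smul, ← map_smul, ← map_add]
    refine hΛ.map_le fun x hx => ?_
    have hr : 0 ≤ eval x (rho d) := by simp [rho]; exact hx.le
    have hxi : x i ^ 2 ≤ 1 :=
      (Finset.single_le_sum (fun j _ => sq_nonneg (x j)) (Finset.mem_univ i)).trans hx.le
    simp only [map_add, map_mul, smul_eval, eval_X, map_ofNat]
    set r := eval x (rho d)
    set u := eval x q
    set v := eval x (pderiv i q)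
    have h1 : 2 * x i * u * v ≤ A * (u * u) + A⁻¹ * (v * v) := by
      have h2 : 0 ≤ A⁻¹ * (A * u - x i * v) ^ 2 := by positivity
      have h3 : A⁻¹ * (A * u - x i * v) ^ 2 =
          A * (u * u) - 2 * x i * u * v + A⁻¹ * (v * v) * x i ^ 2 := by
        field_simp
        ring
      have h4 : A⁻¹ * (v * v) * x i ^ 2 ≤ A⁻¹ * (v * v) :=
        mul_le_of_le_one_right (mul_nonneg (inv_nonneg.2 hA.le) (mul_self_nonneg v)) hxi
      linarith
    have := mul_le_mul_of_nonneg_left h1 hr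
    linarith
  have hqq : 0 ≤ Λ (q * q) := hΛ.nonneg _ fun y _ => by rw [eval_mul]; exact mul_self_nonneg _
  have hrq : 0 ≤ Λ (rho d * (q * q)) := hΛ.nonneg _ fun y hy => by
    have hr : 0 ≤ eval y (rho d) := by simp [rho]; exact hy.le
    rw [eval_mul, eval_mul]; exact mul_nonneg hr (mul_self_nonneg _)
  have hsum : ∑ i, Λ (rho d * (2 * X i * q * pderiv i q)) ≤
      d * (A * Λ (rho d * (q * q)) + A⁻¹ * (K * M * Λ (q * q))) := by
    refine (Finset.sum_le_card_nsmul _ _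
      (A * Λ (rho d * (q * q)) + A⁻¹ * (K * M * Λ (q * q))) fun i _ => (hpt i).trans ?_).trans
      (by rw [Finset.card_univ, Fintype.card_fin, nsmul_eq_mul])
    have h1 := hΛ.map_rho_mul_pderiv_sq_le hα i hq
    have h2 : K * N ^ 2 * Λ (q * q) ≤ K * M * Λ (q * q) := by
      gcongr; simp [M]
    gcongr
    exact h1.trans h2
  have hAK : d * (A⁻¹ * (K * M * Λ (q * q))) ≤ (α + 1) * Λ (q * q) := by
    have : d * (A⁻¹ * (K * M * Λ (q * q))) = d / (d + 1) * ((α + 1) * Λ (q * q)) := by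
      simp only [A]; field_simp
    rw [this]
    refine mul_le_of_le_one_left (by positivity) ?_
    rw [div_le_one (by positivity)]; linarith
  have hmain := hΛ.two_mul_map_sq_eq q
  have h3 : (α + 1) * Λ (q * q) ≤
      (d + 2 * α + 2 + d * ((d + 1) * K / (α + 1))) * M * Λ (rho d * (q * q)) := by
    have h4 : (d + 2 * α + 2) * Λ (rho d * (q * q)) ≤
        (d + 2 * α + 2) * M * Λ (rho d * (q * q)) := by
      refine mul_le_mul_of_nonneg_right (le_mul_of_one_le_right ?_ hM) hrq
      have : (0 : ℝ) ≤ d := Nat.cast_nonneg d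
      linarith
    have h5 : (d + 2 * α + 2 + d * ((d + 1) * K / (α + 1))) * M * Λ (rho d * (q * q)) =
        (d + 2 * α + 2) * M * Λ (rho d * (q * q)) + d * (A * Λ (rho d * (q * q))) := by
      simp only [A]; ring
    linarith
  rw [div_mul_eq_mul_div, div_mul_eq_mul_div, le_div_iff₀ ha]
  linarith

/-- Markov's inequality for one partial derivative. -/
theorem map_pderiv_sq_le (hα : -1 < α) : ∃ C : ℝ, 0 < C ∧
    ∀ Λ : MvPolynomial (Fin d) ℝ →ₗ[ℝ] ℝ, IsBallFunctional α Λ → ∀ (N : ℕ) (i : Fin d)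
      (p : MvPolynomial (Fin d) ℝ), p.totalDegree ≤ N →
      Λ (pderiv i p * pderiv i p) ≤ C * N ^ 4 * Λ (p * p) := by
  have ha : 0 < α + 1 := by linarith
  have hK : 0 < 2 * α + 3 := by linarith
  have h2 : 0 < 2 * α + 2 := by linarith
  set D := (d + 2 * α + 2 + d * ((d + 1) * (2 * α + 3) / (α + 1))) / (α + 1) with hD
  have hD0 : 0 < D := by
    rw [hD, add_assoc (d : ℝ)]; positivity
  -- `D` is the Schur constant and `2α + 3` the Bernstein one; the 2 comes from `(1 + N²)N² ≤ 2N⁴`,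
  -- true also at `N = 0`.
  refine ⟨2 * D * (2 * α + 3), by positivity, fun Λ hΛ N i p hp => ?_⟩
  have hd' : (pderiv i p).totalDegree ≤ N := by
    by_cases h : pderiv i p = 0
    · simp [h]
    · have := totalDegree_pderiv_add_one_le i p h
      omega
  have hpp : 0 ≤ Λ (p * p) := hΛ.nonneg _ fun y _ => by rw [eval_mul]; exact mul_self_nonneg _
  calc Λ (pderiv i p * pderiv i p) ≤ D * (1 + N ^ 2) * Λ (rho d * (pderiv i p * pderiv i p)) :=
        hΛ.map_sq_le hα hd'
    _ ≤ D * (1 + N ^ 2) * ((2 * α + 3) * N ^ 2 * Λ (p * p)) := by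
        gcongr
        exact hΛ.map_rho_mul_pderiv_sq_le hα i hp
    _ = D * (2 * α + 3) * ((1 + N ^ 2) * N ^ 2) * Λ (p * p) := by ring
    _ ≤ D * (2 * α + 3) * (2 * N ^ 4) * Λ (p * p) := by
        have : (1 + N ^ 2) * N ^ 2 ≤ 2 * N ^ 4 := by
          rcases Nat.eq_zero_or_pos N with h | h
          · simp [h]
          · nlinarith [Nat.one_le_pow 2 N h]
        have : ((1 + N ^ 2) * N ^ 2 : ℝ) ≤ 2 * N ^ 4 := by exact_mod_cast this
        gcongr
    _ = _ := by ring

end IsBallFunctional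
end BallMarkov

/-- Differentiating a polynomial along a curve that moves with unit speed in the direction `i`. -/
theorem MvPolynomial.hasDerivAt_eval_of_coord {σ 𝕜 : Type*} [RCLike 𝕜] [DecidableEq σ]
    (p : MvPolynomial σ 𝕜) (i : σ) {z : ℝ → σ → 𝕜} {t : ℝ}
    (hz : ∀ j, HasDerivAt (fun s => z s j) (if j = i then 1 else 0) t) :
    HasDerivAt (fun s => MvPolynomial.eval (z s) p)
      (MvPolynomial.eval (z t) (MvPolynomial.pderiv i p)) t := by
  induction p using MvPolynomial.induction_on with
  | C a => simpa using hasDerivAt_const t a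
  | add p q hp hq =>
    simp only [map_add]
    exact hp.add hq
  | mul_X p j hp =>
    have h := hp.mul (hz j)
    simp only [map_mul, MvPolynomial.eval_X, MvPolynomial.pderiv_mul, map_add]
    convert! h using 2
    rw [MvPolynomial.pderiv_X, Pi.single_apply]
    split_ifs <;> simp_all

/-! ### The weighted measure on the ball and integration by parts -/

namespace BallMarkov
open MvPolynomial

variable {d : ℕ}

/-- In polar coordinates the only possible singularity is that of `(1 - r)^α` at `r = 1`, integrable
as `α > -1`. -/
theorem integrableOn_weight [NeZero d] {α : ℝ} (hα : -1 < α) :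
    IntegrableOn (fun x : EuclideanSpace ℝ (Fin d) => (1 - ‖x‖ ^ 2) ^ α) (Metric.ball 0 1) := by
  have : Nontrivial (EuclideanSpace ℝ (Fin d)) := by
    rw [← Module.finrank_pos_iff (R := ℝ)]
    simpa using NeZero.pos d
  rw [integrableOn_fun_norm_addHaar volume (f := fun y => (1 - y ^ 2) ^ α)]
  have h1 : IntegrableOn (fun y : ℝ => (1 - y) ^ α) (Set.Icc 0 1) := by
    rw [integrableOn_Icc_iff_integrableOn_Ioc,
      ← intervalIntegrable_iff_integrableOn_Ioc_of_le zero_le_one]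
    have := (intervalIntegral.intervalIntegrable_rpow' (a := 1) (b := 0) hα).comp_sub_left 1
    simpa using this
  have h2 : ContinuousOn (fun y : ℝ => (1 + y) ^ α * y ^ (Module.finrank ℝ
      (EuclideanSpace ℝ (Fin d)) - 1)) (Set.Icc 0 1) := by
    refine ContinuousOn.mul (ContinuousOn.rpow_const (by fun_prop) fun y hy => ?_) (by fun_prop)
    exact Or.inl (by linarith [hy.1])
  refine ((h1.mul_continuousOn h2 isCompact_Icc).mono_set Set.Ioo_subset_Icc_self).congr_fun
    (fun y hy => ?_) measurableSet_Ioo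
  have e : 1 - y ^ 2 = (1 - y) * (1 + y) := by ring
  simp only [smul_eq_mul]
  rw [e, Real.mul_rpow (by linarith [hy.2]) (by linarith [hy.1])]
  ring

theorem isFiniteMeasure_ballMeasure [NeZero d] {α : ℝ} (hα : -1 < α) :
    IsFiniteMeasure (ballMeasure d α) :=
  isFiniteMeasure_withDensity_ofReal (integrableOn_weight hα).2

theorem measurable_weight (α : ℝ) :
    Measurable fun x : EuclideanSpace ℝ (Fin d) => (1 - ‖x‖ ^ 2) ^ α := by
  fun_prop

theorem ae_ballMeasure_mem_ball (α : ℝ) : ∀ᵐ x ∂ballMeasure d α, x ∈ Metric.ball 0 1 :=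
  (withDensity_absolutelyContinuous _ _).ae_le (ae_restrict_mem measurableSet_ball)

theorem memLp_of_continuous [NeZero d] {α : ℝ} (hα : -1 < α) {E : Type*} [NormedAddCommGroup E]
    [SecondCountableTopology E] {g : EuclideanSpace ℝ (Fin d) → E} (hg : Continuous g)
    (p : ℝ≥0∞) : MemLp g p (ballMeasure d α) := by
  borelize E
  have := isFiniteMeasure_ballMeasure (d := d) hα
  obtain ⟨C, hC⟩ := (isCompact_closedBall (0 : EuclideanSpace ℝ (Fin d)) 1).exists_bound_of_continuousOn
    hg.continuousOn
  refine (memLp_top_of_bound hg.aestronglyMeasurable C ?_).mono_exponent le_top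
  filter_upwards [ae_ballMeasure_mem_ball α] with x hx
  exact hC x (Metric.ball_subset_closedBall hx)

theorem integral_ballMeasure {α : ℝ} (g : EuclideanSpace ℝ (Fin d) → ℝ) :
    ∫ x, g x ∂ballMeasure d α = ∫ x in Metric.ball 0 1, (1 - ‖x‖ ^ 2) ^ α * g x := by
  rw [ballMeasure, integral_withDensity_eq_integral_toReal_smul
    (measurable_weight α).ennreal_ofReal (by simp)]
  refine setIntegral_congr_fun measurableSet_ball fun x hx => ?_
  have hx' : ‖x‖ < 1 := by simpa using hx
  have : 0 ≤ 1 - ‖x‖ ^ 2 := by nlinarith [norm_nonneg x]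
  simp only [smul_eq_mul, ENNReal.toReal_ofReal (Real.rpow_nonneg this α)]

theorem integrableOn_weight_mul {α : ℝ} {g : EuclideanSpace ℝ (Fin d) → ℝ}
    (hg : Integrable g (ballMeasure d α)) :
    IntegrableOn (fun x => (1 - ‖x‖ ^ 2) ^ α * g x) (Metric.ball 0 1) := by
  rw [ballMeasure, integrable_withDensity_iff_integrable_smul'
    (measurable_weight α).ennreal_ofReal (by simp)] at hg
  refine IntegrableOn.congr_fun hg (fun x hx => ?_) measurableSet_ball
  have hx' : ‖x‖ < 1 := by simpa using hx
  have : 0 ≤ 1 - ‖x‖ ^ 2 := by nlinarith [norm_nonneg x]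
  simp only [smul_eq_mul, ENNReal.toReal_ofReal (Real.rpow_nonneg this α)]

/-- The integrand is the derivative of `(c - t²)^{α+1} φ`, which vanishes at `±√c` because `α + 1 >
0`. -/
theorem integral_slice_eq_zero {α : ℝ} (hα : -1 < α) (c : ℝ) {φ φ' : ℝ → ℝ}
    (hφ : ∀ t, HasDerivAt φ (φ' t) t) :
    ∫ t, Set.indicator {t : ℝ | t ^ 2 < c}
      (fun t => (c - t ^ 2) ^ α * ((c - t ^ 2) * φ' t - 2 * (α + 1) * (t * φ t))) t = 0 := by
  set h : ℝ → ℝ := fun t => (c - t ^ 2) ^ α * ((c - t ^ 2) * φ' t - 2 * (α + 1) * (t * φ t))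
  rcases le_or_gt c 0 with hc | hc
  · have : {t : ℝ | t ^ 2 < c} = ∅ := by
      ext t; simp; nlinarith [sq_nonneg t]
    simp [this]
  have hset : {t : ℝ | t ^ 2 < c} = Set.Ioo (-√c) √c := by
    ext t; simp [Real.sq_lt]
  -- A non-integrable slice has integral 0 by convention, so no integrability hypothesis is needed.
  by_cases hint : Integrable (Set.indicator {t : ℝ | t ^ 2 < c} h)
  swap
  · exact integral_undef hint
  have hle : -√c ≤ √c := by linarith [Real.sqrt_nonneg c]
  rw [hset] at hint ⊢
  rw [integrable_indicator_iff measurableSet_Ioo, ← integrableOn_Ioc_iff_integrableOn_Ioo,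
    ← intervalIntegrable_iff_integrableOn_Ioc_of_le hle] at hint
  rw [integral_indicator measurableSet_Ioo, ← integral_Ioc_eq_integral_Ioo,
    ← intervalIntegral.integral_of_le hle]
  rw [intervalIntegral.integral_eq_sub_of_hasDerivAt_of_le
    (f := fun t => (c - t ^ 2) ^ (α + 1) * φ t) hle ?_ ?_ hint]
  · simp [Real.sq_sqrt hc.le, Real.zero_rpow (by linarith : α + 1 ≠ 0)]
  · refine ContinuousOn.mul (ContinuousOn.rpow_const (by fun_prop) fun y hy => ?_)
      (fun t _ => (hφ t).continuousAt.continuousWithinAt)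
    exact Or.inr (by linarith)
  · intro t ht
    rw [← hset] at ht
    have hpos : 0 < c - t ^ 2 := sub_pos.2 ht
    have h1 : HasDerivAt (fun t : ℝ => c - t ^ 2) (-(2 * t)) t := by
      simpa using (hasDerivAt_pow 2 t).const_sub c
    have h2 := (h1.rpow_const (p := α + 1) (Or.inl hpos.ne')).mul (hφ t)
    convert! h2 using 1
    simp only [h]
    rw [add_sub_cancel_right, Real.rpow_add hpos, Real.rpow_one]
    ring

theorem eval_rho (x : Fin d → ℝ) : eval x (rho d) = 1 - ∑ j, x j ^ 2 := by
  simp [rho]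

theorem continuous_eval_coord (f : MvPolynomial (Fin d) ℝ) :
    Continuous fun x : EuclideanSpace ℝ (Fin d) => eval x.ofLp f := by
  have := f.continuous_eval
  fun_prop

theorem integrable_eval [NeZero d] {α : ℝ} (hα : -1 < α) (f : MvPolynomial (Fin d) ℝ) :
    Integrable (fun x => eval x.ofLp f) (ballMeasure d α) :=
  memLp_one_iff_integrable.1 (memLp_of_continuous hα (continuous_eval_coord f) 1)

/-- Integration against the weight `ρ ^ α` on the unit ball, as a functional on polynomials. -/
noncomputable def ballIntegral [NeZero d] {α : ℝ} (hα : -1 < α) :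
    MvPolynomial (Fin d) ℝ →ₗ[ℝ] ℝ where
  toFun f := ∫ x, eval x.ofLp f ∂ballMeasure d α
  map_add' f g := by
    simp only [map_add]
    exact integral_add (integrable_eval hα f) (integrable_eval hα g)
  map_smul' c f := by
    simp only [smul_eval, RingHom.id_apply, smul_eq_mul]
    exact integral_const_mul c _

theorem ballIntegral_apply [NeZero d] {α : ℝ} (hα : -1 < α) (f : MvPolynomial (Fin d) ℝ) :
    ballIntegral hα f = ∫ x, eval x.ofLp f ∂ballMeasure d α := rfl

theorem ball_indicator_eq (g : (Fin d → ℝ) → ℝ) (α : ℝ) (x : EuclideanSpace ℝ (Fin d)) :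
    (Metric.ball (0 : EuclideanSpace ℝ (Fin d)) 1).indicator
      (fun x => (1 - ‖x‖ ^ 2) ^ α * g x.ofLp) x =
    Set.indicator {x : Fin d → ℝ | ∑ j, x j ^ 2 < 1}
      (fun x => (1 - ∑ j, x j ^ 2) ^ α * g x) x.ofLp := by
  have h : x ∈ Metric.ball (0 : EuclideanSpace ℝ (Fin d)) 1 ↔
      x.ofLp ∈ {x : Fin d → ℝ | ∑ j, x j ^ 2 < 1} := by
    have : ∑ j, x j ^ 2 = ‖x‖ ^ 2 := by simp [EuclideanSpace.norm_sq_eq]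
    rw [Set.mem_ofPred_eq, this, mem_ball_zero_iff, sq_lt_one_iff₀ (norm_nonneg x)]
  by_cases hx : x ∈ Metric.ball (0 : EuclideanSpace ℝ (Fin d)) 1
  · rw [Set.indicator_of_mem hx, Set.indicator_of_mem (h.1 hx)]
    simp [EuclideanSpace.norm_sq_eq]
  · rw [Set.indicator_of_notMem hx, Set.indicator_of_notMem (mt h.2 hx)]

/-- By Fubini, the difference of the two sides is integrated first in `xᵢ`; on the line through `y`
this is the slice identity with `c = 1 - |y|²`. -/
theorem ballIntegral_parts [NeZero d] {α : ℝ} (hα : -1 < α) (i : Fin d)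
    (f : MvPolynomial (Fin d) ℝ) :
    ballIntegral hα (rho d * pderiv i f) = 2 * (α + 1) * ballIntegral hα (X i * f) := by
  rw [← sub_eq_zero, ← smul_eq_mul (2 * (α + 1)), ← map_smul, ← map_sub]
  set g := rho d * pderiv i f - (2 * (α + 1)) • (X i * f)
  set G : (Fin d → ℝ) → ℝ := Set.indicator {x : Fin d → ℝ | ∑ j, x j ^ 2 < 1}
      (fun x => (1 - ∑ j, x j ^ 2) ^ α * eval x g) with hG
  have hmp := PiLp.volume_preserving_toLp (Fin d)
  have hcomp : ∀ x : EuclideanSpace ℝ (Fin d), (Metric.ball 0 1).indicator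
      (fun x : EuclideanSpace ℝ (Fin d) => (1 - ‖x‖ ^ 2) ^ α * eval x.ofLp g) x = G x.ofLp :=
    ball_indicator_eq (fun x => eval x g) α
  have hGint : Integrable G := by
    have h1 := integrableOn_weight_mul (integrable_eval hα g)
    rw [← integrable_indicator_iff measurableSet_ball] at h1
    have h2 := hmp.integrable_comp_of_integrable h1
    refine h2.congr (.of_forall fun x => ?_)
    exact hcomp (WithLp.toLp 2 x)
  have hval : ballIntegral hα g = ∫ x, G x := by
    rw [ballIntegral_apply, integral_ballMeasure, ← integral_indicator measurableSet_ball]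
    simp_rw [hcomp]
    exact (EuclideanSpace.volume_preserving_symm_measurableEquiv_toLp (Fin d)).integral_comp'
      (g := G)
  rw [hval]
  obtain ⟨n, rfl⟩ := Nat.exists_eq_succ_of_ne_zero (NeZero.ne d)
  have hem := (volume_preserving_piFinSuccAbove (fun _ : Fin (n + 1) => ℝ) i).symm
  rw [← hem.integral_comp' (g := G)]
  have hint := (hem.integrable_comp_emb (MeasurableEquiv.measurableEmbedding _)).2 hGint
  rw [Measure.volume_eq_prod] at hint ⊢
  refine (integral_prod_symm _ hint).trans ?_
  refine integral_eq_zero_of_ae (.of_forall fun y => ?_)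
  have hφ : ∀ t, HasDerivAt (fun t : ℝ => eval (i.insertNth (α := fun _ => ℝ) t y) f)
      (eval (i.insertNth (α := fun _ => ℝ) t y) (pderiv i f)) t := fun t => by
    refine hasDerivAt_eval_of_coord f i fun j => ?_
    rcases Fin.eq_self_or_eq_succAbove i j with rfl | ⟨k, rfl⟩
    · simpa using hasDerivAt_id' t
    · simpa using hasDerivAt_const t (y k)
  have key := integral_slice_eq_zero hα (1 - ∑ k, y k ^ 2) hφ
  refine Eq.trans (integral_congr_ae (.of_forall fun t => ?_)) key
  have hs : ∑ j, (i.insertNth (α := fun _ => ℝ) t y j) ^ 2 = t ^ 2 + ∑ k, y k ^ 2 := by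
    rw [Fin.sum_univ_succAbove _ i]; simp
  have he : (1 : ℝ) - (t ^ 2 + ∑ k, y k ^ 2) = 1 - ∑ k, y k ^ 2 - t ^ 2 := by ring
  change G (i.insertNth (α := fun _ => ℝ) t y) = _
  simp only [hG, Set.indicator_apply, Set.mem_ofPred_eq, hs, g, map_sub, map_mul, eval_rho,
    smul_eval, eval_X, Fin.insertNth_apply_same, he, lt_sub_iff_add_lt]

theorem eq_zero_of_eval_eq_zero_on_ball {f : MvPolynomial (Fin d) ℝ}
    (h : ∀ x : Fin d → ℝ, ∑ j, x j ^ 2 < 1 → eval x f = 0) : f = 0 := by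
  have hd : (0 : ℝ) < d + 1 := by positivity
  -- A polynomial vanishing on a product of infinite sets is zero; this cube lies inside the ball.
  refine funext_set (fun _ => Set.Ioo (0 : ℝ) (1 / (d + 1)))
    (fun _ => Set.Ioo_infinite (by positivity)) fun x hx => ?_
  rw [map_zero]
  refine h x ?_
  have hx' : ∀ j, x j ^ 2 ≤ 1 / (d + 1) := fun j => by
    have hj := hx j (Set.mem_univ j)
    have : 1 / ((d : ℝ) + 1) ≤ 1 := by
      rw [div_le_one hd]; linarith [(Nat.cast_nonneg d : (0 : ℝ) ≤ d)]
    nlinarith [hj.1, hj.2]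
  calc ∑ j, x j ^ 2 ≤ ∑ _j : Fin d, (1 : ℝ) / (d + 1) := Finset.sum_le_sum fun j _ => hx' j
    _ = d / (d + 1) := by simp [div_eq_mul_inv]
    _ < 1 := by rw [div_lt_one hd]; linarith

theorem sum_sq_lt_one_of_mem_ball {x : EuclideanSpace ℝ (Fin d)} (hx : x ∈ Metric.ball 0 1) :
    ∑ j, x.ofLp j ^ 2 < 1 := by
  have : ∑ j, x.ofLp j ^ 2 = ‖x‖ ^ 2 := by simp [EuclideanSpace.norm_sq_eq]
  rw [this, sq_lt_one_iff₀ (norm_nonneg x)]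
  simpa using hx

theorem isBallFunctional_ballIntegral [NeZero d] {α : ℝ} (hα : -1 < α) :
    IsBallFunctional (d := d) α (ballIntegral hα) where
  parts := ballIntegral_parts hα
  nonneg f hf := by
    refine integral_nonneg_of_ae ?_
    filter_upwards [ae_ballMeasure_mem_ball α] with x hx
    exact hf _ (sum_sq_lt_one_of_mem_ball hx)
  definite f hf := by
    have hnn : ∀ x : EuclideanSpace ℝ (Fin d), 0 ≤ eval x.ofLp (f * f) := fun x => by
      rw [map_mul]; exact mul_self_nonneg _
    rw [ballIntegral_apply, integral_eq_zero_iff_of_nonneg hnn (integrable_eval hα _)] at hf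
    have h1 : (fun x : EuclideanSpace ℝ (Fin d) => eval x.ofLp f)
        =ᵐ[volume.restrict (Metric.ball 0 1)] fun _ => 0 := by
      have h2 := (ae_withDensity_iff (measurable_weight α).ennreal_ofReal).1 hf
      filter_upwards [h2, ae_restrict_mem measurableSet_ball] with x hx hxb
      have hpos : 0 < 1 - ‖x‖ ^ 2 := by
        rw [sub_pos, sq_lt_one_iff₀ (norm_nonneg x)]
        simpa using hxb
      have := hx (ENNReal.ofReal_pos.2 (Real.rpow_pos_of_pos hpos α)).ne'
      simpa using this
    have h3 := Measure.eqOn_open_of_ae_eq h1 Metric.isOpen_ball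
      (continuous_eval_coord f).continuousOn continuousOn_const
    refine eq_zero_of_eval_eq_zero_on_ball fun x hx => h3 (x := WithLp.toLp 2 x) ?_
    rw [mem_ball_zero_iff, ← sq_lt_one_iff₀ (norm_nonneg _)]
    simpa [EuclideanSpace.norm_sq_eq] using hx

end BallMarkov

/-! ### Complex polynomials, gradients and the passage to norms -/

namespace BallMarkov
open MvPolynomial

variable {d : ℕ}

theorem exists_real_imaginary_parts {N : ℕ} (p : MvPolynomial (Fin d) ℂ)
    (hp : p.totalDegree ≤ N) :
    ∃ a b : MvPolynomial (Fin d) ℝ, a.totalDegree ≤ N ∧ b.totalDegree ≤ N ∧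
      p = map Complex.ofRealHom a + C Complex.I * map Complex.ofRealHom b := by
  have hdeg : ∀ g : ℂ → ℝ, (∑ m ∈ p.support, monomial m (g (coeff m p))).totalDegree ≤ N :=
    fun g => totalDegree_finsetSum_le fun m hm =>
      (totalDegree_monomial_le _ _).trans ((le_totalDegree hm).trans hp)
  refine ⟨_, _, hdeg Complex.re, hdeg Complex.im, ?_⟩
  rw [map_sum, map_sum, Finset.mul_sum, ← Finset.sum_add_distrib]
  conv_lhs => rw [← support_sum_monomial_coeff p]
  refine Finset.sum_congr rfl fun m _ => ?_
  rw [map_monomial, map_monomial, C_mul_monomial, ← map_add]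
  congr 1
  rw [mul_comm]
  exact (Complex.re_add_im _).symm

theorem eval_ofReal_map (x : Fin d → ℝ) (a : MvPolynomial (Fin d) ℝ) :
    eval (fun i => (x i : ℂ)) (map Complex.ofRealHom a) = (eval x a : ℝ) := by
  rw [eval_map, eval₂_eq', eval_eq']
  simp

theorem norm_sq_polyFun (a b : MvPolynomial (Fin d) ℝ) (x : EuclideanSpace ℝ (Fin d)) :
    ‖polyFun (map Complex.ofRealHom a + C Complex.I * map Complex.ofRealHom b) x‖ ^ 2 =
      eval x.ofLp (a * a + b * b) := by
  rw [polyFun, map_add, map_mul, eval_C, eval_ofReal_map, eval_ofReal_map, Complex.sq_norm,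
    Complex.normSq_apply]
  simp

theorem continuous_polyFun (p : MvPolynomial (Fin d) ℂ) : Continuous (polyFun p) := by
  have := p.continuous_eval
  unfold polyFun
  fun_prop

theorem complexGrad_polyFun (p : MvPolynomial (Fin d) ℂ) :
    complexGrad (polyFun p) = fun x => WithLp.toLp 2 fun i => polyFun (pderiv i p) x := by
  funext x
  refine congrArg (WithLp.toLp 2) (funext fun i => HasLineDerivAt.lineDeriv ?_)
  have h := hasDerivAt_eval_of_coord p i (t := 0)
    (z := fun s j => (((x + s • EuclideanSpace.single i (1 : ℝ)) j : ℝ) : ℂ)) fun j => by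
      have : HasDerivAt (fun s : ℝ => x j + s * (if j = i then 1 else 0))
          (if j = i then 1 else 0) 0 := by
        simpa using ((hasDerivAt_id (0 : ℝ)).mul_const (if j = i then (1 : ℝ) else 0)).const_add (x j)
      convert! this.ofReal_comp using 1
      · funext s; simp
      · split_ifs <;> simp
  simpa [HasLineDerivAt, polyFun] using h

theorem continuous_complexGrad_polyFun (p : MvPolynomial (Fin d) ℂ) :
    Continuous (complexGrad (polyFun p)) := by
  rw [complexGrad_polyFun]
  have := fun i => continuous_polyFun (pderiv i p)
  fun_prop

theorem norm_sq_complexGrad_polyFun (a b : MvPolynomial (Fin d) ℝ)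
    (x : EuclideanSpace ℝ (Fin d)) :
    ‖complexGrad (polyFun (map Complex.ofRealHom a + C Complex.I * map Complex.ofRealHom b)) x‖ ^ 2
      = eval x.ofLp (∑ i, (pderiv i a * pderiv i a + pderiv i b * pderiv i b)) := by
  rw [complexGrad_polyFun, EuclideanSpace.norm_sq_eq, map_sum]
  refine Finset.sum_congr rfl fun i _ => ?_
  rw [← norm_sq_polyFun]
  dsimp only
  rw [map_add, pderiv_C_mul, pderiv_map, pderiv_map]

theorem eLpNorm_two_le_of_integral_le {X E F : Type*} [MeasurableSpace X] {μ : Measure X}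
    [NormedAddCommGroup E] [NormedAddCommGroup F] {f : X → E} {g : X → F}
    (hf : MemLp f 2 μ) (hg : MemLp g 2 μ) {c : ℝ} (hc : 0 ≤ c)
    (h : ∫ x, ‖f x‖ ^ 2 ∂μ ≤ c ^ 2 * ∫ x, ‖g x‖ ^ 2 ∂μ) :
    eLpNorm f 2 μ ≤ ENNReal.ofReal c * eLpNorm g 2 μ := by
  rw [hf.eLpNorm_eq_integral_rpow_norm two_ne_zero ENNReal.ofNat_ne_top,
    hg.eLpNorm_eq_integral_rpow_norm two_ne_zero ENNReal.ofNat_ne_top, ← ENNReal.ofReal_mul hc]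
  refine ENNReal.ofReal_le_ofReal ?_
  simp only [ENNReal.toReal_ofNat, Real.rpow_two, ← one_div, ← Real.sqrt_eq_rpow]
  rw [← Real.sqrt_sq hc, ← Real.sqrt_mul (sq_nonneg c)]
  exact Real.sqrt_le_sqrt h

end BallMarkov

open BallMarkov MvPolynomial in
theorem lemma2p9 (d : ℕ) (hd : 1 ≤ d) (α : ℝ) (hα : -1 < α) :
    ∃ C : ℝ, 0 < C ∧ ∀ (N : ℕ) (p : MvPolynomial (Fin d) ℂ), p.totalDegree ≤ N →
      MemLp (polyFun p) 2 (ballMeasure d α) ∧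
      MemLp (complexGrad (polyFun p)) 2 (ballMeasure d α) ∧
      eLpNorm (complexGrad (polyFun p)) 2 (ballMeasure d α) ≤
        ENNReal.ofReal (C * (N : ℝ) ^ 2) * eLpNorm (polyFun p) 2 (ballMeasure d α) := by
  have : NeZero d := ⟨by omega⟩
  obtain ⟨K, hK, h⟩ := IsBallFunctional.map_pderiv_sq_le (d := d) hα
  have hd0 : (0 : ℝ) < d := by exact_mod_cast hd
  -- `K` bounds each of the `d` partial derivatives in squared norm, hence the root.
  refine ⟨√(d * K), by positivity, fun N p hp => ?_⟩
  have hf := memLp_of_continuous hα (continuous_polyFun p) 2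
  have hg := memLp_of_continuous hα (continuous_complexGrad_polyFun p) 2
  refine ⟨hf, hg, eLpNorm_two_le_of_integral_le hg hf (by positivity) ?_⟩
  obtain ⟨a, b, ha, hb, rfl⟩ := exists_real_imaginary_parts p hp
  simp_rw [norm_sq_complexGrad_polyFun, norm_sq_polyFun, ← ballIntegral_apply hα]
  rw [map_sum, mul_pow, Real.sq_sqrt (by positivity), ← pow_mul]
  refine (Finset.sum_le_card_nsmul _ _ (K * N ^ 4 * ballIntegral hα (a * a + b * b))
    fun i _ => ?_).trans (le_of_eq ?_)
  · rw [map_add, map_add, mul_add]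
    exact add_le_add (h _ (isBallFunctional_ballIntegral hα) N i a ha)
      (h _ (isBallFunctional_ballIntegral hα) N i b hb)
  · rw [Finset.card_univ, Fintype.card_fin, nsmul_eq_mul]
    ring
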